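/- Let $d\ge 3$ be an integer, and let $n>d$ and $\alpha>0$ be real numbers. Write $\nabla$, $\Delta$, $|\cdot|$ and $\cdot$ for the gradient, the Laplace-Beltrami operator, the norm and the inner product of tangent vectors on the unit sphere $\mathbb S^{d-1}\subset\mathbb R^d$ with its standard metric, and let $'=\partial_r$. For a function $u=u(r,\omega)$ on $(0,\infty)\times\mathbb S^{d-1}$ let $$\mathsf D u=\Big(\alpha\,u',\ \tfrac1r\,\nabla u\Big),\qquad |\mathsf D u|^2=\alpha^2\,(u')^2+\frac{|\nabla u|^2}{r^2},\qquad \mathsf D u\cdot\mathsf D w=\alpha^2\,u'\,w'+\frac{\nabla u\cdot\nabla w}{r^2},$$ and let $\mathcal L=-\,\mathsf D^*\cdot\mathsf D$, where $\mathsf D^*$ is the formal adjoint of $\mathsf D$ with respect to the measure $r^{n-1}\,dr\,d\omega$, that is, $$\mathcal L\,u=\alpha^2\,r^{1-n}\,\big(r^{n-1}\,u'\big)'+\frac1{r^2}\,\Delta u .$$ Let $\mathsf p$ be a positive function of class $C^3$ on $(0,\infty)\times\mathbb S^{d-1}$. Then, at every point $(r,\omega)\in(0,\infty)\times\mathbb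 S^{d-1}$, $$\begin{aligned} &\tfrac12\,\mathcal L\,|\mathsf D\mathsf p|^2-\mathsf D\mathsf p\cdot\mathsf D\,\mathcal L\,\mathsf p-\tfrac1n\,(\mathcal L\,\mathsf p)^2\\ &\quad=\alpha^4\,\frac{n-1}{n}\left[\mathsf p''-\frac{\mathsf p'}{r}-\frac{\Delta\mathsf p}{\alpha^2\,(n-1)\,r^2}\right]^2+\frac{2\,\alpha^2}{r^2}\left|\nabla\mathsf p'-\frac{\nabla\mathsf p}{r}\right|^2\\ &\qquad+\frac1{r^4}\left[\tfrac12\,\Delta|\nabla\mathsf p|^2-\nabla\mathsf p\cdot\nabla\Delta\mathsf p-\tfrac1{n-1}\,(\Delta\mathsf p)^2-(n-2)\,\alpha^2\,|\nabla\mathsf p|^2\right]. \end{aligned}$$ -/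

import Mathlib

open Set Metric Module
open scoped Manifold RealInnerProductSpace

noncomputable section

/-- The unit sphere `𝕊^{d-1}` of `ℝ^d`, with Mathlib's structure of a smooth manifold. -/
abbrev UnitSphere (d : ℕ) : Type := sphere (0 : EuclideanSpace ℝ (Fin d)) 1

/-- `dim ℝ^d = (d - 1) + 1` for `d ≠ 0`: this is what makes Mathlib's manifold structure on the
sphere, modelled on `ℝ^{d-1}`, available. -/
instance finrankFact (d : ℕ) [NeZero d] :
    Fact (finrank ℝ (EuclideanSpace ℝ (Fin d)) = (d - 1) + 1) :=
  ⟨by rw [finrank_euclideanSpace_fin]; have := NeZero.pos d; omega⟩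

/-- The tangent space at `ω`, realized as the hyperplane `ω^⊥` of `ℝ^d`; the inner product
inherited from `ℝ^d` is the standard metric of the sphere. -/
abbrev Tan {d : ℕ} (ω : UnitSphere d) : Submodule ℝ (EuclideanSpace ℝ (Fin d)) :=
  (ℝ ∙ (ω : EuclideanSpace ℝ (Fin d)))ᗮ

/-- The identification of the abstract tangent space of the manifold `𝕊^{d-1}` with the hyperplane
`ω^⊥`, given by the differential of the inclusion `𝕊^{d-1} → ℝ^d`. -/
def tangentEquiv {d : ℕ} [NeZero d] (ω : UnitSphere d) :
    TangentSpace (𝓡 (d - 1)) ω ≃ₗ[ℝ] Tan ω :=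
  (LinearEquiv.ofInjective
    (mvfderiv (𝓡 (d - 1)) ((↑) : UnitSphere d → EuclideanSpace ℝ (Fin d)) ω).toLinearMap
    (injective_mvfderiv_subtypeVal_sphere ω)).trans
  (LinearEquiv.ofEq _ _ (range_mvfderiv_subtypeVal ω))

/-- The differential at `ω` of a map from the sphere to a normed space. -/
def sphereDeriv {d : ℕ} [NeZero d] {V : Type*} [NormedAddCommGroup V] [NormedSpace ℝ V]
    (f : UnitSphere d → V) (ω : UnitSphere d) : Tan ω →ₗ[ℝ] V :=
  (mvfderiv (𝓡 (d - 1)) f ω).toLinearMap ∘ₗ (tangentEquiv ω).symm.toLinearMap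

/-- The Riemannian gradient `∇ f` on the sphere: the tangent vector that represents the
differential of `f` for the standard metric. -/
def sphereGrad {d : ℕ} [NeZero d] (f : UnitSphere d → ℝ) (ω : UnitSphere d) : Tan ω :=
  (InnerProductSpace.toDual ℝ (Tan ω)).symm (LinearMap.toContinuousLinearMap (sphereDeriv f ω))

/-- The Riemannian divergence of a tangent vector field `X` on the sphere: the trace of
`v ↦ ∇_v X`, where the Levi-Civita covariant derivative `∇_v X` is the orthogonal projection onto
the tangent space of the derivative of `X` as a map into `ℝ^d`. -/
def sphereDiv {d : ℕ} [NeZero d] (X : (ω : UnitSphere d) → Tan ω) (ω : UnitSphere d) : ℝ :=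
  LinearMap.trace ℝ (Tan ω)
    ((Tan ω).orthogonalProjectionOnto.toLinearMap ∘ₗ
      sphereDeriv (fun η => (X η : EuclideanSpace ℝ (Fin d))) ω)

/-- The Laplace-Beltrami operator `Δ = div ∇` on the sphere. -/
def sphereLap {d : ℕ} [NeZero d] (f : UnitSphere d → ℝ) (ω : UnitSphere d) : ℝ :=
  sphereDiv (sphereGrad f) ω

/-- The gradient `D u = (α ∂_r u, r⁻¹ ∇ u)` of a function `u (r, ω)` on `(0, ∞) × 𝕊^{d-1}`, with
the Euclidean product norm on `ℝ × ω^⊥`. -/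
def coneGrad {d : ℕ} [NeZero d] (α : ℝ) (u : ℝ → UnitSphere d → ℝ) (r : ℝ) (ω : UnitSphere d) :
    WithLp 2 (ℝ × Tan ω) :=
  WithLp.toLp 2 (α * deriv (fun s => u s ω) r, r⁻¹ • sphereGrad (u r) ω)

/-- The operator `-D^*`, where `D^*` is the formal adjoint of `D` for the measure
`dμ = r^{n-1} dr dω`: it maps `X = (X₁, X₂)` to
`α r^{1-n} ∂_r (r^{n-1} X₁) + r⁻¹ div X₂`. -/
def coneDiv {d : ℕ} [NeZero d] (α n : ℝ)
    (X : ℝ → (ω : UnitSphere d) → WithLp 2 (ℝ × Tan ω)) (r : ℝ) (ω : UnitSphere d) : ℝ :=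
  α * r ^ (1 - n) * deriv (fun s => s ^ (n - 1) * (X s ω).fst) r
    + r⁻¹ * sphereDiv (fun η => (X r η).snd) ω

/-- The Laplacian `𝓛 = -D^* · D`. -/
def coneLap {d : ℕ} [NeZero d] (α n : ℝ) (u : ℝ → UnitSphere d → ℝ) (r : ℝ)
    (ω : UnitSphere d) : ℝ :=
  coneDiv α n (coneGrad α u) r ω

end

/-! The identity is a pointwise computation that never uses the curvature of the sphere: `Δ|∇p|²`
and `∇p · ∇Δp` enter through the angular part of the operators and survive untouched in the last
bracket. Once both second-order terms are expanded (`coneLap_norm_sq_coneGrad`,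
`inner_coneGrad_coneLap`), the terms in `p'''`, `∇p''` and `Δp'` cancel, because `∂_r` commutes with
`∇` and `Δ`. In the remaining terms, put `x = p''`, `S = Δp / (α² r²)` and `y = (n - 1) p' / r + S`.
The identity `x² + y²/(n - 1) - (x + y)²/n = ((n - 1)/n) (x - y/(n - 1))²` produces the first square
and the term `-(Δp)²/(n - 1)`. The mixed terms are `2|∇p'|²/r² - 4 ∇p·∇p'/r³ + (4 - n)|∇p|²/r⁴`,
times `α²`; completing the square leaves `-(n - 2)|∇p|²/r⁴`. The analytic work is to justify these
derivatives. Functions and tangent fields on the sphere are extended to the ambient space, where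
regularity and the symmetry of second derivatives are those of ordinary calculus (`ConeContDiff`,
`ConeContDiff.hasDerivAt_sphereDeriv`). Class `C³` suffices: `|Dp|²` is `C²` and `𝓛p` is `C¹`. -/

section

/-! ### Differentiability through ambient extensions -/

variable {d : ℕ}

/-- `f` is the restriction to the sphere of a map on `ℝ^d` that is differentiable at `ω`. -/
def ExtDifferentiableAt {V : Type*} [NormedAddCommGroup V] [NormedSpace ℝ V]
    (f : UnitSphere d → V) (ω : UnitSphere d) : Prop :=
  ∃ F : EuclideanSpace ℝ (Fin d) → V, DifferentiableAt ℝ F ω ∧ ∀ η : UnitSphere d, f η = F η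

variable {V : Type*} [NormedAddCommGroup V] [NormedSpace ℝ V] {ω : UnitSphere d}

theorem ExtDifferentiableAt.add {f g : UnitSphere d → V} (hf : ExtDifferentiableAt f ω)
    (hg : ExtDifferentiableAt g ω) : ExtDifferentiableAt (fun η => f η + g η) ω := by
  obtain ⟨F, hF, hf⟩ := hf
  obtain ⟨G, hG, hg⟩ := hg
  exact ⟨fun x => F x + G x, hF.add hG, fun η => by simp only [hf, hg]⟩

theorem ExtDifferentiableAt.smul {f : UnitSphere d → ℝ} {g : UnitSphere d → V}
    (hf : ExtDifferentiableAt f ω) (hg : ExtDifferentiableAt g ω) :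
    ExtDifferentiableAt (fun η => f η • g η) ω := by
  obtain ⟨F, hF, hf⟩ := hf
  obtain ⟨G, hG, hg⟩ := hg
  exact ⟨fun x => F x • G x, hF.smul hG, fun η => by simp only [hf, hg]⟩

theorem extDifferentiableAt_const (c : V) : ExtDifferentiableAt (fun _ => c) ω :=
  ⟨fun _ => c, differentiableAt_const c, fun _ => rfl⟩

end

/-! ### First-order calculus on the sphere: product rules for gradient and divergence -/

section

variable {d : ℕ} [NeZero d]

/-- Chain rule for `F` composed with the inclusion, whose differential is `tangentEquiv`. Any
extension may therefore be used to compute derivatives along the sphere. -/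
theorem sphereDeriv_eq_fderiv {V : Type*} [NormedAddCommGroup V] [NormedSpace ℝ V]
    {f : UnitSphere d → V} {F : EuclideanSpace ℝ (Fin d) → V} {ω : UnitSphere d}
    (hF : DifferentiableAt ℝ F ω) (hf : ∀ η : UnitSphere d, f η = F η) (v : Tan ω) :
    sphereDeriv f ω v = fderiv ℝ F ω v := by
  obtain rfl : f = F ∘ ((↑) : UnitSphere d → EuclideanSpace ℝ (Fin d)) := funext hf
  obtain ⟨w, rfl⟩ := (tangentEquiv ω).surjective v
  have hc : MDifferentiableAt (𝓡 (d - 1)) 𝓘(ℝ, EuclideanSpace ℝ (Fin d))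
      ((↑) : UnitSphere d → EuclideanSpace ℝ (Fin d)) ω :=
    (contMDiff_coe_sphere (m := 1) ω).mdifferentiableAt one_ne_zero
  have hF' : MDifferentiableAt 𝓘(ℝ, EuclideanSpace ℝ (Fin d)) 𝓘(ℝ, V) F
      (ω : EuclideanSpace ℝ (Fin d)) := hF.mdifferentiableAt
  have hw : ((tangentEquiv ω w : Tan ω) : EuclideanSpace ℝ (Fin d)) =
      mvfderiv (𝓡 (d - 1)) ((↑) : UnitSphere d → EuclideanSpace ℝ (Fin d)) ω w := rfl
  rw [hw]
  have := mfderiv_comp_apply (I := 𝓡 (d - 1)) (I' := 𝓘(ℝ, EuclideanSpace ℝ (Fin d)))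
    (I'' := 𝓘(ℝ, V)) ω hF' hc w
  simp only [sphereDeriv, LinearMap.comp_apply, LinearEquiv.coe_coe, LinearEquiv.symm_apply_apply]
  rw [mfderiv_eq_fderiv] at this
  exact this

variable {V : Type*} [NormedAddCommGroup V] [NormedSpace ℝ V] {ω : UnitSphere d}

theorem sphereDeriv_const (c : V) (v : Tan ω) : sphereDeriv (fun _ => c) ω v = 0 := by
  rw [sphereDeriv_eq_fderiv (F := fun _ => c) (differentiableAt_const c) (fun _ => rfl)]
  simp

theorem sphereDeriv_add {f g : UnitSphere d → V} (hf : ExtDifferentiableAt f ω)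
    (hg : ExtDifferentiableAt g ω) (v : Tan ω) :
    sphereDeriv (fun η => f η + g η) ω v = sphereDeriv f ω v + sphereDeriv g ω v := by
  obtain ⟨F, hF, hf⟩ := hf
  obtain ⟨G, hG, hg⟩ := hg
  rw [sphereDeriv_eq_fderiv hF hf, sphereDeriv_eq_fderiv hG hg,
    sphereDeriv_eq_fderiv (F := fun x => F x + G x) (hF.add hG) (fun η => by rw [hf, hg]),
    fderiv_fun_add hF hG]
  rfl

theorem sphereDeriv_smul {f : UnitSphere d → ℝ} {g : UnitSphere d → V}
    (hf : ExtDifferentiableAt f ω) (hg : ExtDifferentiableAt g ω) (v : Tan ω) :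
    sphereDeriv (fun η => f η • g η) ω v = f ω • sphereDeriv g ω v + sphereDeriv f ω v • g ω := by
  obtain ⟨F, hF, hf⟩ := hf
  obtain ⟨G, hG, hg⟩ := hg
  rw [sphereDeriv_eq_fderiv hF hf, sphereDeriv_eq_fderiv hG hg,
    sphereDeriv_eq_fderiv (F := fun x => F x • G x) (hF.smul hG) (fun η => by rw [hf, hg]),
    fderiv_fun_smul hF hG, hf, hg]
  simp

theorem inner_sphereGrad (f : UnitSphere d → ℝ) (v : Tan ω) :
    ⟪sphereGrad f ω, v⟫ = sphereDeriv f ω v := by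
  simp [sphereGrad]

theorem sphereGrad_eq_sum (f : UnitSphere d → ℝ) {ι : Type*} [Fintype ι]
    (b : OrthonormalBasis ι ℝ (Tan ω)) :
    sphereGrad f ω = ∑ i, sphereDeriv f ω (b i) • b i := by
  conv_lhs => rw [← b.sum_repr' (sphereGrad f ω)]
  simp only [real_inner_comm, inner_sphereGrad]

theorem sphereDiv_eq_sum (X : (ω : UnitSphere d) → Tan ω) {ι : Type*} [Fintype ι]
    (b : OrthonormalBasis ι ℝ (Tan ω)) :
    sphereDiv X ω = ∑ i, ⟪(b i : EuclideanSpace ℝ (Fin d)),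
      sphereDeriv (fun η => (X η : EuclideanSpace ℝ (Fin d))) ω (b i)⟫ := by
  rw [sphereDiv, LinearMap.trace_eq_sum_inner _ b]
  refine Finset.sum_congr rfl fun i _ => ?_
  simp

theorem sphereGrad_add {f g : UnitSphere d → ℝ} (hf : ExtDifferentiableAt f ω)
    (hg : ExtDifferentiableAt g ω) :
    sphereGrad (fun η => f η + g η) ω = sphereGrad f ω + sphereGrad g ω := by
  refine ext_inner_right ℝ fun v => ?_
  rw [inner_add_left]
  simp only [inner_sphereGrad, sphereDeriv_add hf hg]

theorem sphereGrad_mul {f g : UnitSphere d → ℝ} (hf : ExtDifferentiableAt f ω)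
    (hg : ExtDifferentiableAt g ω) :
    sphereGrad (fun η => f η * g η) ω = f ω • sphereGrad g ω + g ω • sphereGrad f ω := by
  refine ext_inner_right ℝ fun v => ?_
  rw [inner_add_left, real_inner_smul_left, real_inner_smul_left]
  simp only [inner_sphereGrad]
  have := sphereDeriv_smul hf hg v
  simp only [smul_eq_mul] at this
  rw [this, mul_comm (g ω)]

theorem sphereGrad_const_mul (c : ℝ) {f : UnitSphere d → ℝ} (hf : ExtDifferentiableAt f ω) :
    sphereGrad (fun η => c * f η) ω = c • sphereGrad f ω := by
  refine ext_inner_right ℝ fun v => ?_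
  rw [real_inner_smul_left]
  simp only [inner_sphereGrad]
  have := sphereDeriv_smul (extDifferentiableAt_const c) hf v
  simpa [sphereDeriv_const] using this

theorem sphereDiv_add {X Y : (ω : UnitSphere d) → Tan ω}
    (hX : ExtDifferentiableAt (fun η => (X η : EuclideanSpace ℝ (Fin d))) ω)
    (hY : ExtDifferentiableAt (fun η => (Y η : EuclideanSpace ℝ (Fin d))) ω) :
    sphereDiv (fun η => X η + Y η) ω = sphereDiv X ω + sphereDiv Y ω := by
  simp only [sphereDiv_eq_sum _ (stdOrthonormalBasis ℝ (Tan ω)), ← Finset.sum_add_distrib,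
    Submodule.coe_add, sphereDeriv_add hX hY, inner_add_right]

theorem sphereDiv_smul {f : UnitSphere d → ℝ} {X : (ω : UnitSphere d) → Tan ω}
    (hf : ExtDifferentiableAt f ω)
    (hX : ExtDifferentiableAt (fun η => (X η : EuclideanSpace ℝ (Fin d))) ω) :
    sphereDiv (fun η => f η • X η) ω = f ω * sphereDiv X ω + ⟪sphereGrad f ω, X ω⟫ := by
  simp only [sphereDiv_eq_sum _ (stdOrthonormalBasis ℝ (Tan ω)),
    Submodule.coe_smul, sphereDeriv_smul hf hX, inner_add_right, real_inner_smul_right,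
    Finset.sum_add_distrib, Finset.mul_sum]
  congr 1
  rw [sphereGrad_eq_sum f (stdOrthonormalBasis ℝ (Tan ω)), sum_inner]
  refine Finset.sum_congr rfl fun i _ => ?_
  rw [real_inner_smul_left, Submodule.coe_inner]

theorem sphereDiv_const_smul (c : ℝ) {X : (ω : UnitSphere d) → Tan ω}
    (hX : ExtDifferentiableAt (fun η => (X η : EuclideanSpace ℝ (Fin d))) ω) :
    sphereDiv (fun η => c • X η) ω = c * sphereDiv X ω := by
  simp only [sphereDiv_eq_sum _ (stdOrthonormalBasis ℝ (Tan ω)), Submodule.coe_smul,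
    sphereDeriv_smul (extDifferentiableAt_const c) hX, sphereDeriv_const, zero_smul, add_zero,
    real_inner_smul_right, Finset.mul_sum]

/-- The gradient is the tangential projection of any ambient vector representing the differential.
The point `ω` enters the formula only as a vector of `ℝ^d`, so the formula itself extends off the
sphere; this gives the regularity of the gradient without a moving frame. -/
theorem coe_sphereGrad_eq {f : UnitSphere d → ℝ} {g : EuclideanSpace ℝ (Fin d)}
    (hg : ∀ v : Tan ω, ⟪g, (v : EuclideanSpace ℝ (Fin d))⟫ = sphereDeriv f ω v) :
    (sphereGrad f ω : EuclideanSpace ℝ (Fin d)) =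
      g - ⟪(ω : EuclideanSpace ℝ (Fin d)), g⟫ • (ω : EuclideanSpace ℝ (Fin d)) := by
  have h1 : sphereGrad f ω = (Tan ω).orthogonalProjectionOnto g := by
    refine ext_inner_right ℝ fun v => ?_
    rw [inner_sphereGrad, ← hg, Submodule.inner_orthogonalProjectionOnto_eq_of_mem_right]
  have h2 : ‖(ω : EuclideanSpace ℝ (Fin d))‖ = 1 := norm_eq_of_mem_sphere ω
  rw [h1]
  have := Submodule.starProjection_orthogonal_val (𝕜 := ℝ)
    (K := ℝ ∙ (ω : EuclideanSpace ℝ (Fin d))) g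
  rw [Submodule.starProjection_unit_singleton ℝ h2] at this
  exact this

/-- Cyclicity of the trace moves the inclusion of `ω^⊥` to the left, where it combines with the
projection into `x ↦ x - ⟪ω, x⟫ ω` on `ℝ^d`. The resulting ambient formula gives the regularity of
the divergence. -/
theorem sphereDiv_eq_trace_sub {X : (ω : UnitSphere d) → Tan ω}
    {A : EuclideanSpace ℝ (Fin d) →ₗ[ℝ] EuclideanSpace ℝ (Fin d)}
    (hA : ∀ v : Tan ω, sphereDeriv (fun η => (X η : EuclideanSpace ℝ (Fin d))) ω v = A v) :
    sphereDiv X ω = LinearMap.trace ℝ _ A - ⟪(ω : EuclideanSpace ℝ (Fin d)), A ω⟫ := by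
  have h2 : ‖(ω : EuclideanSpace ℝ (Fin d))‖ = 1 := norm_eq_of_mem_sphere ω
  set P : EuclideanSpace ℝ (Fin d) →ₗ[ℝ] Tan ω := (Tan ω).orthogonalProjectionOnto.toLinearMap
  have h3 : sphereDeriv (fun η => (X η : EuclideanSpace ℝ (Fin d))) ω = A ∘ₗ (Tan ω).subtype :=
    LinearMap.ext hA
  have h5 : ∀ x, ((Tan ω).subtype ∘ₗ P) x =
      x - ⟪(ω : EuclideanSpace ℝ (Fin d)), x⟫ • (ω : EuclideanSpace ℝ (Fin d)) := by
    intro x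
    have := Submodule.starProjection_orthogonal_val (𝕜 := ℝ)
      (K := ℝ ∙ (ω : EuclideanSpace ℝ (Fin d))) x
    rw [Submodule.starProjection_unit_singleton ℝ h2] at this
    exact this
  have h6 : ((Tan ω).subtype ∘ₗ P) ∘ₗ A =
      A - (innerₛₗ ℝ (ω : EuclideanSpace ℝ (Fin d)) ∘ₗ A).smulRight
        (ω : EuclideanSpace ℝ (Fin d)) := by
    ext1 x
    rw [LinearMap.comp_apply, h5]
    simp
  rw [sphereDiv, h3, ← LinearMap.comp_assoc, LinearMap.trace_comp_comm', ← LinearMap.comp_assoc,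
    h6, map_sub, LinearMap.trace_smulRight]
  simp

end

/-! ### Regularity on the cone and radial derivatives -/

section

/-- The open set `(0, ∞) × (ℝ^d ∖ {0})`. -/
def coneDomain (d : ℕ) : TopologicalSpace.Opens (ℝ × EuclideanSpace ℝ (Fin d)) :=
  ⟨Set.Ioi 0 ×ˢ {0}ᶜ, isOpen_Ioi.prod isOpen_compl_singleton⟩

/-- `u` is the restriction to `(0, ∞) × 𝕊^{d-1}` of a map of class `C^k` on
`(0, ∞) × (ℝ^d ∖ {0})`. -/
def ConeContDiff {d : ℕ} {V : Type*} [NormedAddCommGroup V] [NormedSpace ℝ V] (k : ℕ)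
    (u : ℝ → UnitSphere d → V) : Prop :=
  ∃ U : ℝ × EuclideanSpace ℝ (Fin d) → V, ContDiffOn ℝ k U (coneDomain d) ∧
    ∀ s : ℝ, 0 < s → ∀ η : UnitSphere d, u s η = U (s, η)

variable {d : ℕ}

theorem mem_coneDomain {s : ℝ} (hs : 0 < s) (η : UnitSphere d) :
    (s, (η : EuclideanSpace ℝ (Fin d))) ∈ coneDomain d :=
  ⟨hs, ne_zero_of_mem_unit_sphere η⟩

/-- The extension is homogeneous of degree zero in `x`, namely `(r, x) ↦ p(r, x/|x|)`; normalization
is smooth away from the origin. -/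
theorem coneContDiff_of_contMDiffOn [NeZero d] {k : ℕ} {p : ℝ → UnitSphere d → ℝ}
    (hp : ContMDiffOn (𝓘(ℝ, ℝ).prod (𝓡 (d - 1))) 𝓘(ℝ, ℝ) k
      (fun z : ℝ × UnitSphere d => p z.1 z.2) (Set.Ioi (0 : ℝ) ×ˢ Set.univ)) :
    ConeContDiff k p := by
  classical
  have hn : ∀ x : EuclideanSpace ℝ (Fin d), x ≠ 0 →
      ‖x‖⁻¹ • x ∈ sphere (0 : EuclideanSpace ℝ (Fin d)) 1 := by
    intro x hx
    rw [mem_sphere_zero_iff_norm, norm_smul, norm_inv, norm_norm,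
      inv_mul_cancel₀ (norm_ne_zero_iff.2 hx)]
  let ν : coneDomain d → EuclideanSpace ℝ (Fin d) := fun z => ‖z.1.2‖⁻¹ • z.1.2
  have hν' : ∀ z, ν z ∈ sphere (0 : EuclideanSpace ℝ (Fin d)) 1 := fun z => hn _ z.2.2
  have hν : ContMDiff 𝓘(ℝ, ℝ × EuclideanSpace ℝ (Fin d)) 𝓘(ℝ, EuclideanSpace ℝ (Fin d)) k ν := by
    intro z
    refine (contMDiffAt_subtype_iff (U := coneDomain d)
      (f := fun z : ℝ × EuclideanSpace ℝ (Fin d) => ‖z.2‖⁻¹ • z.2)).2 ?_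
    refine ContDiffAt.contMDiffAt ?_
    have h0 : z.1.2 ≠ 0 := z.2.2
    exact ((contDiffAt_snd.norm ℝ h0).inv (norm_ne_zero_iff.2 h0)).smul contDiffAt_snd
  have hfst : ContMDiff 𝓘(ℝ, ℝ × EuclideanSpace ℝ (Fin d)) 𝓘(ℝ, ℝ) k
      (fun z : coneDomain d => z.1.1) := by
    intro z
    refine (contMDiffAt_subtype_iff (U := coneDomain d)
      (f := fun z : ℝ × EuclideanSpace ℝ (Fin d) => z.1)).2 ?_
    exact contDiffAt_fst.contMDiffAt
  have hpair := hfst.prodMk (hν.codRestrict_sphere (n := d - 1) hν')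
  -- The value `0` at `x = 0` is arbitrary: that point lies outside `coneDomain`.
  refine ⟨fun z => if h : z.2 = 0 then 0 else p z.1 ⟨_, hn z.2 h⟩, ?_, ?_⟩
  · intro z hz
    refine ContDiffAt.contDiffWithinAt (ContMDiffAt.contDiffAt ?_)
    refine (contMDiffAt_subtype_iff (U := coneDomain d) (x := ⟨z, hz⟩)).1 ?_
    have hq : ContMDiffAt (𝓘(ℝ, ℝ).prod (𝓡 (d - 1))) 𝓘(ℝ, ℝ) k
        (fun z : ℝ × UnitSphere d => p z.1 z.2) (z.1, ⟨ν ⟨z, hz⟩, hν' ⟨z, hz⟩⟩) :=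
      hp.contMDiffAt ((isOpen_Ioi.prod isOpen_univ).mem_nhds ⟨hz.1, trivial⟩)
    refine (ContMDiffAt.comp (⟨z, hz⟩ : coneDomain d) hq hpair.contMDiffAt).congr_of_eventuallyEq ?_
    refine Filter.Eventually.of_forall fun y => ?_
    have h0 : y.1.2 ≠ 0 := y.2.2
    simp only [h0, dite_false]
    rfl
  · intro s hs η
    have h0 : (η : EuclideanSpace ℝ (Fin d)) ≠ 0 := ne_zero_of_mem_unit_sphere η
    simp only [h0, dite_false]
    congr 1
    ext1
    simp

variable {V : Type*} [NormedAddCommGroup V] [NormedSpace ℝ V] {k : ℕ}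

theorem ConeContDiff.of_le {l : ℕ} {u : ℝ → UnitSphere d → V} (hu : ConeContDiff k u)
    (h : l ≤ k) : ConeContDiff l u := by
  obtain ⟨U, hU, hu⟩ := hu
  exact ⟨U, hU.of_le (by exact_mod_cast h), hu⟩

theorem ConeContDiff.add {u w : ℝ → UnitSphere d → V} (hu : ConeContDiff k u)
    (hw : ConeContDiff k w) : ConeContDiff k (fun s η => u s η + w s η) := by
  obtain ⟨U, hU, hu⟩ := hu
  obtain ⟨W, hW, hw⟩ := hw
  exact ⟨fun z => U z + W z, hU.add hW, fun s hs η => by simp only [hu s hs, hw s hs]⟩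

theorem ConeContDiff.smul {u : ℝ → UnitSphere d → ℝ} {w : ℝ → UnitSphere d → V}
    (hu : ConeContDiff k u) (hw : ConeContDiff k w) :
    ConeContDiff k (fun s η => u s η • w s η) := by
  obtain ⟨U, hU, hu⟩ := hu
  obtain ⟨W, hW, hw⟩ := hw
  exact ⟨fun z => U z • W z, hU.smul hW, fun s hs η => by simp only [hu s hs, hw s hs]⟩

theorem ConeContDiff.mul {u w : ℝ → UnitSphere d → ℝ}
    (hu : ConeContDiff k u) (hw : ConeContDiff k w) :
    ConeContDiff k (fun s η => u s η * w s η) :=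
  hu.smul hw

theorem ConeContDiff.of_radial {a : ℝ → ℝ} (ha : ContDiffOn ℝ k a (Set.Ioi 0)) :
    ConeContDiff (d := d) k (fun s _ => a s) :=
  ⟨fun z => a z.1, ha.comp contDiffOn_fst fun _ hz => hz.1, fun _ _ _ => rfl⟩

theorem ConeContDiff.norm_sq {d' : ℕ} {X : ℝ → UnitSphere d → EuclideanSpace ℝ (Fin d')}
    (hX : ConeContDiff k X) : ConeContDiff k (fun s η => ‖X s η‖ ^ 2) := by
  obtain ⟨U, hU, hu⟩ := hX
  exact ⟨fun z => ‖U z‖ ^ 2, hU.norm_sq ℝ, fun s hs η => by simp only [hu s hs]⟩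

theorem ConeContDiff.extDifferentiableAt {u : ℝ → UnitSphere d → V} (hu : ConeContDiff k u)
    (hk : 1 ≤ k) {s : ℝ} (hs : 0 < s) (ω : UnitSphere d) : ExtDifferentiableAt (u s) ω := by
  obtain ⟨U, hU, hu⟩ := hu
  refine ⟨fun x => U (s, x), ?_, hu s hs⟩
  have h1 : DifferentiableAt ℝ U (s, (ω : EuclideanSpace ℝ (Fin d))) :=
    (hU.contDiffAt ((coneDomain d).isOpen.mem_nhds (mem_coneDomain hs ω))).differentiableAt
      (by exact_mod_cast (by omega : k ≠ 0))
  exact h1.comp _ ((differentiableAt_const s).prodMk differentiableAt_id)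

theorem hasDerivAt_of_coneExtension {u : ℝ → UnitSphere d → V}
    {U : ℝ × EuclideanSpace ℝ (Fin d) → V} (hu : ∀ s : ℝ, 0 < s → ∀ η, u s η = U (s, η))
    {s : ℝ} (hs : 0 < s) {ω : UnitSphere d}
    (hU : DifferentiableAt ℝ U (s, (ω : EuclideanSpace ℝ (Fin d)))) :
    HasDerivAt (fun t => u t ω)
      (fderiv ℝ U (s, (ω : EuclideanSpace ℝ (Fin d))) (1, 0)) s := by
  have h1 : HasDerivAt (fun t : ℝ => (t, (ω : EuclideanSpace ℝ (Fin d)))) (1, 0) s :=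
    (hasDerivAt_id s).prodMk (hasDerivAt_const s _)
  refine (hU.hasFDerivAt.comp_hasDerivAt s h1).congr_of_eventuallyEq ?_
  -- The extension agrees with `u` for positive radii only, which is enough near `s > 0`.
  filter_upwards [lt_mem_nhds hs] with t ht
  exact hu t ht ω

theorem ConeContDiff.hasDerivAt {u : ℝ → UnitSphere d → V} (hu : ConeContDiff k u)
    (hk : 1 ≤ k) {s : ℝ} (hs : 0 < s) (ω : UnitSphere d) :
    HasDerivAt (fun t => u t ω) (deriv (fun t => u t ω) s) s := by
  obtain ⟨U, hU, hu⟩ := hu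
  refine (hasDerivAt_of_coneExtension hu hs ?_).differentiableAt.hasDerivAt
  exact (hU.contDiffAt ((coneDomain d).isOpen.mem_nhds (mem_coneDomain hs ω))).differentiableAt
      (by exact_mod_cast (by omega : k ≠ 0))

theorem ConeContDiff.deriv {u : ℝ → UnitSphere d → V} (hu : ConeContDiff (k + 1) u) :
    ConeContDiff k (fun s η => deriv (fun t => u t η) s) := by
  obtain ⟨U, hU, hu⟩ := hu
  refine ⟨fun z => fderiv ℝ U z (1, 0), ?_, fun s hs η => ?_⟩
  · exact (hU.fderiv_of_isOpen (coneDomain d).isOpen (by push_cast; exact le_rfl)).clm_apply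
      contDiffOn_const
  · refine (hasDerivAt_of_coneExtension hu hs ?_).deriv
    exact (hU.contDiffAt ((coneDomain d).isOpen.mem_nhds (mem_coneDomain hs η))).differentiableAt
      (by exact_mod_cast k.succ_ne_zero)

/-! ### Loss of regularity under the spherical operators, and their commutation with `∂_r` -/

variable [NeZero d]

theorem sphereDeriv_of_coneExtension {u : ℝ → UnitSphere d → V}
    {U : ℝ × EuclideanSpace ℝ (Fin d) → V} (hu : ∀ s : ℝ, 0 < s → ∀ η, u s η = U (s, η))
    {s : ℝ} (hs : 0 < s) {ω : UnitSphere d}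
    (hU : DifferentiableAt ℝ U (s, (ω : EuclideanSpace ℝ (Fin d)))) (v : Tan ω) :
    sphereDeriv (u s) ω v =
      fderiv ℝ U (s, (ω : EuclideanSpace ℝ (Fin d))) (0, (v : EuclideanSpace ℝ (Fin d))) := by
  have h1 : HasFDerivAt (fun x : EuclideanSpace ℝ (Fin d) => (s, x))
      (ContinuousLinearMap.inr ℝ ℝ (EuclideanSpace ℝ (Fin d))) ω :=
    hasFDerivAt_prodMk_right s _
  have h2 := hU.hasFDerivAt.comp (ω : EuclideanSpace ℝ (Fin d)) h1
  rw [sphereDeriv_eq_fderiv h2.differentiableAt (hu s hs), h2.fderiv]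
  rfl

theorem ConeContDiff.sphereGrad {u : ℝ → UnitSphere d → ℝ} (hu : ConeContDiff (k + 1) u) :
    ConeContDiff k (fun s η => (sphereGrad (u s) η : EuclideanSpace ℝ (Fin d))) := by
  obtain ⟨U, hU, hu⟩ := hu
  let g : ℝ × EuclideanSpace ℝ (Fin d) → EuclideanSpace ℝ (Fin d) := fun z =>
    (InnerProductSpace.toDual ℝ (EuclideanSpace ℝ (Fin d))).symm
      (fderiv ℝ U z ∘L ContinuousLinearMap.inr ℝ ℝ (EuclideanSpace ℝ (Fin d)))
  have hg : ContDiffOn ℝ k g (coneDomain d) :=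
    (InnerProductSpace.toDual ℝ (EuclideanSpace ℝ (Fin d))).symm.contDiff.comp_contDiffOn
      ((hU.fderiv_of_isOpen (coneDomain d).isOpen (by push_cast; exact le_rfl)).clm_comp
        contDiffOn_const)
  refine ⟨fun z => g z - ⟪z.2, g z⟫ • z.2, ?_, fun s hs η => ?_⟩
  · exact hg.sub ((contDiffOn_snd.inner ℝ hg).smul contDiffOn_snd)
  · refine coe_sphereGrad_eq fun v => ?_
    rw [sphereDeriv_of_coneExtension hu hs]
    · simp [g]
    · exact (hU.contDiffAt ((coneDomain d).isOpen.mem_nhds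
        (mem_coneDomain hs η))).differentiableAt (by exact_mod_cast k.succ_ne_zero)

theorem ConeContDiff.sphereDiv {X : ℝ → (η : UnitSphere d) → Tan η}
    (hX : ConeContDiff (k + 1) (fun s η => (X s η : EuclideanSpace ℝ (Fin d)))) :
    ConeContDiff k (fun s η => sphereDiv (X s) η) := by
  obtain ⟨U, hU, hu⟩ := hX
  let A : ℝ × EuclideanSpace ℝ (Fin d) →
      EuclideanSpace ℝ (Fin d) →L[ℝ] EuclideanSpace ℝ (Fin d) := fun z =>
    fderiv ℝ U z ∘L ContinuousLinearMap.inr ℝ ℝ (EuclideanSpace ℝ (Fin d))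
  have hA : ContDiffOn ℝ k A (coneDomain d) :=
    (hU.fderiv_of_isOpen (coneDomain d).isOpen (by push_cast; exact le_rfl)).clm_comp
        contDiffOn_const
  -- The trace as a continuous linear form, so that composing it with a `C^k` map stays `C^k`.
  let T : (EuclideanSpace ℝ (Fin d) →L[ℝ] EuclideanSpace ℝ (Fin d)) →L[ℝ] ℝ :=
    LinearMap.toContinuousLinearMap (LinearMap.trace ℝ _ ∘ₗ ContinuousLinearMap.coeLM ℝ)
  refine ⟨fun z => T (A z) - ⟪z.2, A z z.2⟫, ?_, fun s hs η => ?_⟩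
  · exact (T.contDiff.comp_contDiffOn hA).sub
      (contDiffOn_snd.inner ℝ (hA.clm_apply contDiffOn_snd))
  · refine sphereDiv_eq_trace_sub fun v => ?_
    rw [sphereDeriv_of_coneExtension (u := fun s η => (X s η : EuclideanSpace ℝ (Fin d))) hu hs]
    · simp [A]
    · exact (hU.contDiffAt ((coneDomain d).isOpen.mem_nhds
        (mem_coneDomain hs η))).differentiableAt (by exact_mod_cast k.succ_ne_zero)

theorem ConeContDiff.sphereLap {u : ℝ → UnitSphere d → ℝ} (hu : ConeContDiff (k + 2) u) :
    ConeContDiff k (fun s η => sphereLap (u s) η) :=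
  ConeContDiff.sphereDiv (ConeContDiff.sphereGrad hu)

/-- Both orders of differentiation are values of the second derivative of the extension on `(1, 0)`
and `(0, v)`, so its symmetry lets `∂_r` pass through the spherical differential. The commutation
with `∇`, `div` and `Δ` follows from this. -/
theorem ConeContDiff.hasDerivAt_sphereDeriv {u : ℝ → UnitSphere d → V}
    (hu : ConeContDiff k u) (hk : 2 ≤ k) {s : ℝ} (hs : 0 < s) (ω : UnitSphere d) (v : Tan ω) :
    HasDerivAt (fun t => sphereDeriv (u t) ω v)
      (sphereDeriv (fun η => _root_.deriv (fun t => u t η) s) ω v) s := by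
  obtain ⟨U, hU, hu⟩ := hu.of_le hk
  have hat : ∀ {t : ℝ}, 0 < t → ∀ η : UnitSphere d,
      ContDiffAt ℝ 2 U (t, (η : EuclideanSpace ℝ (Fin d))) := fun ht η =>
    hU.contDiffAt ((coneDomain d).isOpen.mem_nhds (mem_coneDomain ht η))
  have hd : ∀ {t : ℝ}, 0 < t → ∀ η : UnitSphere d,
      DifferentiableAt ℝ U (t, (η : EuclideanSpace ℝ (Fin d))) := fun ht η =>
    (hat ht η).differentiableAt two_ne_zero
  have hd2 : DifferentiableAt ℝ (fderiv ℝ U) (s, (ω : EuclideanSpace ℝ (Fin d))) :=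
    ((hat hs ω).fderiv_right (m := 1) (by norm_num)).differentiableAt one_ne_zero
  have h1 : HasDerivAt (fun t => sphereDeriv (u t) ω v)
      (fderiv ℝ (fderiv ℝ U) (s, (ω : EuclideanSpace ℝ (Fin d))) (1, 0)
        (0, (v : EuclideanSpace ℝ (Fin d)))) s := by
    have h2 : HasDerivAt (fun t : ℝ => (t, (ω : EuclideanSpace ℝ (Fin d)))) (1, 0) s :=
      (hasDerivAt_id s).prodMk (hasDerivAt_const s _)
    have h3 : HasDerivAt (fun t : ℝ => fderiv ℝ U (t, (ω : EuclideanSpace ℝ (Fin d))))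
        (fderiv ℝ (fderiv ℝ U) (s, (ω : EuclideanSpace ℝ (Fin d))) (1, 0)) s :=
      hd2.hasFDerivAt.comp_hasDerivAt s h2
    have h4 := h3.clm_apply
      (hasDerivAt_const s ((0 : ℝ), (v : EuclideanSpace ℝ (Fin d))))
    rw [map_zero, add_zero] at h4
    refine h4.congr_of_eventuallyEq ?_
    filter_upwards [lt_mem_nhds hs] with t ht
    exact sphereDeriv_of_coneExtension hu ht (hd ht ω) v
  have h5 : sphereDeriv (fun η => _root_.deriv (fun t => u t η) s) ω v =
      fderiv ℝ (fderiv ℝ U) (s, (ω : EuclideanSpace ℝ (Fin d)))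
        (0, (v : EuclideanSpace ℝ (Fin d))) (1, 0) := by
    rw [sphereDeriv_of_coneExtension (u := fun t η => _root_.deriv (fun t => u t η) t)
      (U := fun z => fderiv ℝ U z (1, 0))
      (fun t ht η => (hasDerivAt_of_coneExtension hu ht (hd ht η)).deriv) hs
      (hd2.clm_apply (differentiableAt_const _)),
      (hd2.hasFDerivAt.clm_apply (hasFDerivAt_const _ _)).fderiv]
    simp
  rw [h5, ((hat hs ω).isSymmSndFDerivAt (by simp)).eq]
  exact h1

theorem ConeContDiff.hasDerivAt_sphereGrad {u : ℝ → UnitSphere d → ℝ}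
    (hu : ConeContDiff k u) (hk : 2 ≤ k) {s : ℝ} (hs : 0 < s) (ω : UnitSphere d) :
    HasDerivAt (fun t => _root_.sphereGrad (u t) ω)
      (_root_.sphereGrad (fun η => _root_.deriv (fun t => u t η) s) ω) s := by
  -- With `ω` fixed, one orthonormal basis of `ω^⊥` serves for all radii.
  simp only [sphereGrad_eq_sum _ (stdOrthonormalBasis ℝ (Tan ω))]
  exact HasDerivAt.fun_sum fun i _ => (hu.hasDerivAt_sphereDeriv hk hs ω _).smul_const _

theorem ConeContDiff.hasDerivAt_sphereDiv {X Y : ℝ → (η : UnitSphere d) → Tan η}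
    (hX : ConeContDiff k (fun s η => (X s η : EuclideanSpace ℝ (Fin d)))) (hk : 2 ≤ k)
    {s : ℝ} (hs : 0 < s) (ω : UnitSphere d) (hY : ∀ η, HasDerivAt (fun t => X t η) (Y s η) s) :
    HasDerivAt (fun t => _root_.sphereDiv (X t) ω) (_root_.sphereDiv (Y s) ω) s := by
  -- `hY` differentiates inside each tangent space, whereas the divergence differentiates fields
  -- valued in `ℝ^d`; the linear inclusion transports one to the other.
  have hY' : (fun η => (Y s η : EuclideanSpace ℝ (Fin d))) =
      fun η => _root_.deriv (fun t => (X t η : EuclideanSpace ℝ (Fin d))) s := by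
    funext η
    exact ((Tan η).subtypeL.hasFDerivAt.comp_hasDerivAt s (hY η)).deriv.symm
  simp only [sphereDiv_eq_sum _ (stdOrthonormalBasis ℝ (Tan ω)), hY']
  refine HasDerivAt.fun_sum fun i _ => ?_
  simpa using (hasDerivAt_const s _).inner ℝ (hX.hasDerivAt_sphereDeriv hk hs ω _)

theorem ConeContDiff.hasDerivAt_sphereLap {u : ℝ → UnitSphere d → ℝ}
    (hu : ConeContDiff k u) (hk : 3 ≤ k) {s : ℝ} (hs : 0 < s) (ω : UnitSphere d) :
    HasDerivAt (fun t => _root_.sphereLap (u t) ω)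
      (_root_.sphereLap (fun η => _root_.deriv (fun t => u t η) s) ω) s :=
  ConeContDiff.hasDerivAt_sphereDiv (X := fun t => _root_.sphereGrad (u t))
    (Y := fun t => _root_.sphereGrad (fun η => _root_.deriv (fun t => u t η) t))
    (hu.of_le hk).sphereGrad le_rfl hs ω
    (fun η => hu.hasDerivAt_sphereGrad (by omega) hs η)

end

/-! ### Expansion of the cone operators in radial and angular derivatives -/

section

variable {d : ℕ} [NeZero d]

theorem coneLap_eq {α n : ℝ} {u : ℝ → UnitSphere d → ℝ} (hu : ConeContDiff 2 u) {s : ℝ}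
    (hs : 0 < s) (ω : UnitSphere d) :
    coneLap α n u s ω =
      α ^ 2 * (deriv (fun t => deriv (fun t => u t ω) t) s + (n - 1) / s * deriv (fun t => u t ω) s)
        + (s ^ 2)⁻¹ * sphereLap (u s) ω := by
  have h1 : sphereDiv (fun η => (coneGrad α u s η).snd) ω = s⁻¹ * sphereLap (u s) ω :=
    sphereDiv_const_smul s⁻¹ (hu.sphereGrad.extDifferentiableAt le_rfl hs ω)
  have h2 : HasDerivAt (fun t : ℝ => t ^ (n - 1) * (α * deriv (fun t => u t ω) t))
      ((n - 1) * s ^ (n - 1 - 1) * (α * deriv (fun t => u t ω) s)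
        + s ^ (n - 1) * (α * deriv (fun t => deriv (fun t => u t ω) t) s)) s :=
    (Real.hasDerivAt_rpow_const (Or.inl hs.ne')).mul
      ((hu.deriv.hasDerivAt le_rfl hs ω).const_mul α)
  have h3 : deriv (fun t => t ^ (n - 1) * (coneGrad α u t ω).fst) s = _ := h2.deriv
  -- The only fact needed to eliminate the real powers of `s`.
  have h4 : s ^ (1 - n) * s ^ (n - 1) = 1 := by
    rw [← Real.rpow_add hs]
    simp
  rw [coneLap, coneDiv, h1, h3, Real.rpow_sub_one hs.ne']
  have h5 := hs.ne'
  field_simp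
  linear_combination (α ^ 2 * s * (s * deriv (fun t => deriv (fun t => u t ω) t) s
    + (n - 1) * deriv (fun t => u t ω) s)) * h4

theorem inner_coneGrad (α : ℝ) (u w : ℝ → UnitSphere d → ℝ) (r : ℝ) (ω : UnitSphere d) :
    inner ℝ (coneGrad α u r ω) (coneGrad α w r ω) =
      α ^ 2 * (deriv (fun s => u s ω) r * deriv (fun s => w s ω) r)
        + (r ^ 2)⁻¹ * ⟪sphereGrad (u r) ω, sphereGrad (w r) ω⟫ := by
  simp only [coneGrad, WithLp.prod_inner_apply, real_inner_smul_left, real_inner_smul_right]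
  rw [RCLike.inner_apply, conj_trivial]
  ring

theorem norm_sq_coneGrad (α : ℝ) (u : ℝ → UnitSphere d → ℝ) (r : ℝ) (ω : UnitSphere d) :
    ‖coneGrad α u r ω‖ ^ 2 =
      α ^ 2 * (deriv (fun s => u s ω) r * deriv (fun s => u s ω) r)
        + (r ^ 2)⁻¹ * ‖sphereGrad (u r) ω‖ ^ 2 := by
  rw [← real_inner_self_eq_norm_sq, inner_coneGrad, real_inner_self_eq_norm_sq]

/-- The gradients must be added at every point, since the divergence then differentiates the field;
regularity of the gradients themselves matters only at `ω`. -/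
theorem sphereLap_add {f g : UnitSphere d → ℝ} {ω : UnitSphere d}
    (hf : ∀ η, ExtDifferentiableAt f η) (hg : ∀ η, ExtDifferentiableAt g η)
    (hf' : ExtDifferentiableAt (fun η => (sphereGrad f η : EuclideanSpace ℝ (Fin d))) ω)
    (hg' : ExtDifferentiableAt (fun η => (sphereGrad g η : EuclideanSpace ℝ (Fin d))) ω) :
    sphereLap (fun η => f η + g η) ω = sphereLap f ω + sphereLap g ω := by
  have h : sphereGrad (fun η => f η + g η) = fun η => sphereGrad f η + sphereGrad g η :=
    funext fun η => sphereGrad_add (hf η) (hg η)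
  rw [sphereLap, h, sphereDiv_add hf' hg']
  rfl

theorem sphereLap_const_mul (c : ℝ) {f : UnitSphere d → ℝ} {ω : UnitSphere d}
    (hf : ∀ η, ExtDifferentiableAt f η)
    (hf' : ExtDifferentiableAt (fun η => (sphereGrad f η : EuclideanSpace ℝ (Fin d))) ω) :
    sphereLap (fun η => c * f η) ω = c * sphereLap f ω := by
  have h : sphereGrad (fun η => c * f η) = fun η => c • sphereGrad f η :=
    funext fun η => sphereGrad_const_mul c (hf η)
  rw [sphereLap, h, sphereDiv_const_smul c hf']
  rfl

theorem sphereLap_mul_self {f : UnitSphere d → ℝ} {ω : UnitSphere d}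
    (hf : ∀ η, ExtDifferentiableAt f η)
    (hf' : ExtDifferentiableAt (fun η => (sphereGrad f η : EuclideanSpace ℝ (Fin d))) ω) :
    sphereLap (fun η => f η * f η) ω = 2 * (f ω * sphereLap f ω + ‖sphereGrad f ω‖ ^ 2) := by
  have h : sphereGrad (fun η => f η * f η) = fun η => f η • sphereGrad f η + f η • sphereGrad f η :=
    funext fun η => sphereGrad_mul (hf η) (hf η)
  have h2 : ExtDifferentiableAt
      (fun η => ((f η • sphereGrad f η : Tan η) : EuclideanSpace ℝ (Fin d))) ω :=
    (hf ω).smul hf'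
  rw [sphereLap, h, sphereDiv_add h2 h2, sphereDiv_smul (hf ω) hf', real_inner_self_eq_norm_sq,
    sphereLap]
  ring

/-- The Laplacian of the squared length of the cone gradient. -/
theorem coneLap_norm_sq_coneGrad {α n : ℝ} {p : ℝ → UnitSphere d → ℝ} (hp : ConeContDiff 3 p)
    {r : ℝ} (hr : 0 < r) (ω : UnitSphere d) {a b c N i j m : ℝ}
    (ha : deriv (fun t => p t ω) r = a)
    (hb : deriv (fun t => deriv (fun t => p t ω) t) r = b)
    (hc : deriv (fun t => deriv (fun t => deriv (fun t => p t ω) t) t) r = c)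
    (hN : ‖sphereGrad (p r) ω‖ ^ 2 = N)
    (hi : ⟪sphereGrad (p r) ω, sphereGrad (fun η => deriv (fun t => p t η) r) ω⟫ = i)
    (hj : ⟪sphereGrad (p r) ω,
      sphereGrad (fun η => deriv (fun t => deriv (fun t => p t η) t) r) ω⟫ = j)
    (hm : ‖sphereGrad (fun η => deriv (fun t => p t η) r) ω‖ ^ 2 = m) :
    coneLap α n (fun s η => ‖coneGrad α p s η‖ ^ 2) r ω =
      α ^ 2 * ((α ^ 2 * (2 * (b * b + a * c)) +
          (6 / r ^ 4 * N - 8 / r ^ 3 * i + 2 / r ^ 2 * (m + j)))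
        + (n - 1) / r * (α ^ 2 * (2 * (a * b)) + (-2 / r ^ 3 * N + 2 / r ^ 2 * i)))
      + (r ^ 2)⁻¹ * (α ^ 2 *
          (2 * (a * sphereLap (fun η => deriv (fun t => p t η) r) ω + m))
        + (r ^ 2)⁻¹ * sphereLap (fun η => ‖sphereGrad (p r) η‖ ^ 2) ω) := by
  have hp1 := hp.deriv
  have hp2 := hp1.deriv
  have hr2 : ContDiffOn ℝ 2 (fun s : ℝ => (s ^ 2)⁻¹) (Set.Ioi 0) :=
    (contDiff_id.pow 2).contDiffOn.inv fun s (hs : 0 < s) => (pow_pos hs 2).ne'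
  have hsq : ConeContDiff 2
      (fun s (η : UnitSphere d) => deriv (fun t => p t η) s * deriv (fun t => p t η) s) :=
    hp1.mul hp1
  have hnorm : ConeContDiff 2 (fun s (η : UnitSphere d) => ‖sphereGrad (p s) η‖ ^ 2) :=
    ConeContDiff.norm_sq hp.sphereGrad
  have hA : ConeContDiff 2 (fun s (η : UnitSphere d) =>
      α ^ 2 * (deriv (fun t => p t η) s * deriv (fun t => p t η) s)) :=
    (ConeContDiff.of_radial contDiffOn_const).mul hsq
  have hB : ConeContDiff 2 (fun s (η : UnitSphere d) =>
      (s ^ 2)⁻¹ * ‖sphereGrad (p s) η‖ ^ 2) :=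
    (ConeContDiff.of_radial hr2).mul hnorm
  have d0 : ∀ {s : ℝ}, 0 < s → HasDerivAt (fun t => deriv (fun t => p t ω) t)
      (deriv (fun t => deriv (fun t => p t ω) t) s) s := fun hs =>
    hp1.hasDerivAt (by norm_num) hs ω
  have d1 : ∀ {s : ℝ}, 0 < s → HasDerivAt (fun t => deriv (fun t => deriv (fun t => p t ω) t) t)
      (deriv (fun t => deriv (fun t => deriv (fun t => p t ω) t) t) s) s := fun hs =>
    hp2.hasDerivAt (by norm_num) hs ω
  have g0 : ∀ {s : ℝ}, 0 < s → HasDerivAt (fun t => sphereGrad (p t) ω)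
      (sphereGrad (fun η => deriv (fun t => p t η) s) ω) s := fun hs =>
    hp.hasDerivAt_sphereGrad (by norm_num) hs ω
  have g1 : ∀ {s : ℝ}, 0 < s → HasDerivAt (fun s => sphereGrad (fun η => deriv (fun t => p t η) s) ω)
      (sphereGrad (fun η => deriv (fun t => deriv (fun t => p t η) t) s) ω) s := fun hs =>
    hp1.hasDerivAt_sphereGrad (by norm_num) hs ω
  -- Valid at every positive radius, because this first derivative is differentiated once more in
  -- `e2`.
  have e1 : ∀ {s : ℝ}, 0 < s → HasDerivAt
      (fun s => α ^ 2 * (deriv (fun t => p t ω) s * deriv (fun t => p t ω) s)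
        + (s ^ 2)⁻¹ * ‖sphereGrad (p s) ω‖ ^ 2)
      (α ^ 2 * (2 * (deriv (fun t => p t ω) s * deriv (fun t => deriv (fun t => p t ω) t) s))
        + (-2 / s ^ 3 * ‖sphereGrad (p s) ω‖ ^ 2 + 2 / s ^ 2 *
          ⟪sphereGrad (p s) ω, sphereGrad (fun η => deriv (fun t => p t η) s) ω⟫)) s := by
    intro s hs
    have hs' := hs.ne'
    refine ((((d0 hs).mul (d0 hs)).const_mul (α ^ 2)).add
      (((hasDerivAt_pow 2 s).inv (pow_ne_zero 2 hs')).mul (g0 hs).norm_sq)).congr_deriv ?_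
    simp only [Pi.inv_apply]
    field_simp
    push_cast
    ring
  have e2 : HasDerivAt
      (fun s => α ^ 2 * (2 * (deriv (fun t => p t ω) s * deriv (fun t => deriv (fun t => p t ω) t) s))
        + (-2 / s ^ 3 * ‖sphereGrad (p s) ω‖ ^ 2 + 2 / s ^ 2 *
          ⟪sphereGrad (p s) ω, sphereGrad (fun η => deriv (fun t => p t η) s) ω⟫))
      (α ^ 2 * (2 * (b * b + a * c)) +
          (6 / r ^ 4 * N - 8 / r ^ 3 * i + 2 / r ^ 2 * (m + j))) r := by
    have hr' := hr.ne'
    refine (((((d0 hr).mul (d1 hr)).const_mul 2).const_mul (α ^ 2)).add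
      ((((hasDerivAt_const r (-2 : ℝ)).div (hasDerivAt_pow 3 r) (pow_ne_zero 3 hr')).mul
        (g0 hr).norm_sq).add
      (((hasDerivAt_const r (2 : ℝ)).div (hasDerivAt_pow 2 r) (pow_ne_zero 2 hr')).mul
        ((g0 hr).inner ℝ (g1 hr))))).congr_deriv ?_
    rw [real_inner_self_eq_norm_sq, ha, hb, hc, hN, hi, hj, hm]
    simp only [Pi.div_apply]
    field_simp
    push_cast
    ring
  have hfun : (fun s η => ‖coneGrad α p s η‖ ^ 2) = fun s η =>
      α ^ 2 * (deriv (fun t => p t η) s * deriv (fun t => p t η) s)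
        + (s ^ 2)⁻¹ * ‖sphereGrad (p s) η‖ ^ 2 :=
    funext₂ fun s η => norm_sq_coneGrad α p s η
  have e3 : deriv (fun t => deriv (fun s => α ^ 2 * (deriv (fun t => p t ω) s
      * deriv (fun t => p t ω) s) + (s ^ 2)⁻¹ * ‖sphereGrad (p s) ω‖ ^ 2) t) r =
      α ^ 2 * (2 * (b * b + a * c)) +
          (6 / r ^ 4 * N - 8 / r ^ 3 * i + 2 / r ^ 2 * (m + j)) := by
    refine (e2.congr_of_eventuallyEq ?_).deriv
    filter_upwards [lt_mem_nhds hr] with t ht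
    exact (e1 ht).deriv
  have e4 := (e1 hr).deriv
  rw [ha, hb, hN, hi] at e4
  rw [hfun, coneLap_eq (hA.add hB) hr, e3, e4,
    sphereLap_add (fun η => hA.extDifferentiableAt one_le_two hr η)
      (fun η => hB.extDifferentiableAt one_le_two hr η)
      (hA.sphereGrad.extDifferentiableAt le_rfl hr ω)
      (hB.sphereGrad.extDifferentiableAt le_rfl hr ω),
    sphereLap_const_mul (α ^ 2) (fun η => hsq.extDifferentiableAt one_le_two hr η)
      (hsq.sphereGrad.extDifferentiableAt le_rfl hr ω),
    sphereLap_const_mul (r ^ 2)⁻¹ (fun η => hnorm.extDifferentiableAt one_le_two hr η)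
      (hnorm.sphereGrad.extDifferentiableAt le_rfl hr ω),
    sphereLap_mul_self (fun η => hp1.extDifferentiableAt one_le_two hr η)
      (hp1.sphereGrad.extDifferentiableAt le_rfl hr ω), ha, hm]

/-- The inner product of the cone gradients of `p` and of its Laplacian. -/
theorem inner_coneGrad_coneLap {α n : ℝ} {p : ℝ → UnitSphere d → ℝ} (hp : ConeContDiff 3 p)
    {r : ℝ} (hr : 0 < r) (ω : UnitSphere d) {a b c i j : ℝ}
    (ha : deriv (fun t => p t ω) r = a)
    (hb : deriv (fun t => deriv (fun t => p t ω) t) r = b)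
    (hc : deriv (fun t => deriv (fun t => deriv (fun t => p t ω) t) t) r = c)
    (hi : ⟪sphereGrad (p r) ω, sphereGrad (fun η => deriv (fun t => p t η) r) ω⟫ = i)
    (hj : ⟪sphereGrad (p r) ω,
      sphereGrad (fun η => deriv (fun t => deriv (fun t => p t η) t) r) ω⟫ = j) :
    inner ℝ (coneGrad α p r ω) (coneGrad α (coneLap α n p) r ω) =
      α ^ 2 * (a * (α ^ 2 * (c + (n - 1) / r * b - (n - 1) / r ^ 2 * a)
        + (-2 / r ^ 3 * sphereLap (p r) ω
          + (r ^ 2)⁻¹ * sphereLap (fun η => deriv (fun t => p t η) r) ω)))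
      + (r ^ 2)⁻¹ * (α ^ 2 * (j + (n - 1) / r * i)
        + (r ^ 2)⁻¹ * ⟪sphereGrad (p r) ω, sphereGrad (sphereLap (p r)) ω⟫) := by
  have hp1 := hp.deriv
  have hp2 := hp1.deriv
  have hr' := hr.ne'
  -- The expansion is needed for `s` near `r` and for all `η`, since `𝓛p` is then differentiated in
  -- both variables.
  have hL : ∀ {s : ℝ}, 0 < s → ∀ η, coneLap α n p s η = _ := fun hs η =>
    coneLap_eq (α := α) (n := n) (hp.of_le (by norm_num)) hs η
  have h1 : deriv (fun s => coneLap α n p s ω) r =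
      α ^ 2 * (c + (n - 1) / r * b - (n - 1) / r ^ 2 * a) + (-2 / r ^ 3 * sphereLap (p r) ω
          + (r ^ 2)⁻¹ * sphereLap (fun η => deriv (fun t => p t η) r) ω) := by
    have h2 := (((hp2.hasDerivAt le_rfl hr ω).add
      (((hasDerivAt_const r (n - 1)).div (hasDerivAt_id r) hr').mul
        (hp1.hasDerivAt one_le_two hr ω))).const_mul (α ^ 2)).add
      (((hasDerivAt_pow 2 r).inv (pow_ne_zero 2 hr')).mul (hp.hasDerivAt_sphereLap le_rfl hr ω))
    refine (HasDerivAt.congr_of_eventuallyEq (h2.congr_deriv ?_) ?_).deriv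
    · rw [ha, hb, hc]
      simp only [Pi.inv_apply, Pi.div_apply, id]
      field_simp
      push_cast
      ring
    · filter_upwards [lt_mem_nhds hr] with t ht
      exact hL ht ω
  have h3 : coneLap α n p r = fun η =>
      α ^ 2 * (deriv (fun t => deriv (fun t => p t η) t) r
        + (n - 1) / r * deriv (fun t => p t η) r) + (r ^ 2)⁻¹ * sphereLap (p r) η :=
    funext fun η => hL hr η
  have x1 := hp1.extDifferentiableAt one_le_two hr ω
  have x2 := hp2.extDifferentiableAt le_rfl hr ω
  -- All three derivatives of `p` are used here: `Δp` is just `C¹`.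
  have x3 : ExtDifferentiableAt (sphereLap (p r)) ω :=
    (ConeContDiff.sphereLap (k := 1) hp).extDifferentiableAt le_rfl hr ω
  have x4 := (extDifferentiableAt_const ((n - 1) / r)).smul x1
  have x5 := x2.add x4
  have x6 := (extDifferentiableAt_const (α ^ 2)).smul x5
  have x7 := (extDifferentiableAt_const (r ^ 2)⁻¹).smul x3
  simp only [smul_eq_mul] at x4 x5 x6 x7
  rw [inner_coneGrad, h1, h3, sphereGrad_add x6 x7, sphereGrad_const_mul _ x5,
    sphereGrad_add x2 x4, sphereGrad_const_mul _ x1, sphereGrad_const_mul _ x3, inner_add_right,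
    real_inner_smul_right, real_inner_smul_right, inner_add_right, real_inner_smul_right, ha, hi,
    hj]

end

/-! ### Cancellation of third-order terms and completion of the squares -/

theorem lemma3 (d : ℕ) [NeZero d] (hd : 3 ≤ d) (n α : ℝ) (hn : (d : ℝ) < n) (hα : 0 < α)
    (p : ℝ → UnitSphere d → ℝ)
    (hpos : ∀ r : ℝ, 0 < r → ∀ ω : UnitSphere d, 0 < p r ω)
    (hp : ContMDiffOn (𝓘(ℝ, ℝ).prod (𝓡 (d - 1))) 𝓘(ℝ, ℝ) 3
      (fun z : ℝ × UnitSphere d => p z.1 z.2) (Set.Ioi (0 : ℝ) ×ˢ Set.univ))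
    (r : ℝ) (hr : 0 < r) (ω : UnitSphere d) :
    (1 / 2) * coneLap α n (fun s η => ‖coneGrad α p s η‖ ^ 2) r ω
        - inner ℝ (coneGrad α p r ω) (coneGrad α (coneLap α n p) r ω)
        - (1 / n) * (coneLap α n p r ω) ^ 2
      = α ^ 4 * ((n - 1) / n) *
          (deriv (deriv (fun s => p s ω)) r - deriv (fun s => p s ω) r / r
            - sphereLap (p r) ω / (α ^ 2 * (n - 1) * r ^ 2)) ^ 2
        + (2 * α ^ 2 / r ^ 2) *
          ‖sphereGrad (fun η => deriv (fun s => p s η) r) ω - r⁻¹ • sphereGrad (p r) ω‖ ^ 2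
        + (1 / r ^ 4) *
          ((1 / 2) * sphereLap (fun η => ‖sphereGrad (p r) η‖ ^ 2) ω
            - inner ℝ (sphereGrad (p r) ω) (sphereGrad (sphereLap (p r)) ω)
            - (1 / (n - 1)) * (sphereLap (p r) ω) ^ 2
            - (n - 2) * α ^ 2 * ‖sphereGrad (p r) ω‖ ^ 2) := by
  have hp3 : ConeContDiff 3 p := coneContDiff_of_contMDiffOn (by exact_mod_cast hp)
  have hm : ‖sphereGrad (fun η => deriv (fun s => p s η) r) ω - r⁻¹ • sphereGrad (p r) ω‖ ^ 2 =
      ‖sphereGrad (fun η => deriv (fun s => p s η) r) ω‖ ^ 2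
        - 2 * r⁻¹ * ⟪sphereGrad (p r) ω, sphereGrad (fun η => deriv (fun s => p s η) r) ω⟫
        + (r ^ 2)⁻¹ * ‖sphereGrad (p r) ω‖ ^ 2 := by
    rw [norm_sub_sq_real, real_inner_smul_right, norm_smul, real_inner_comm, mul_pow, norm_inv,
      Real.norm_of_nonneg hr.le]
    ring
  rw [coneLap_norm_sq_coneGrad hp3 hr ω rfl rfl rfl rfl rfl rfl rfl,
    inner_coneGrad_coneLap hp3 hr ω rfl rfl rfl rfl rfl, coneLap_eq (hp3.of_le (by norm_num)) hr, hm]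
  have hd' : (3 : ℝ) ≤ d := by exact_mod_cast hd
  have h1 : n ≠ 0 := by linarith
  have h2 : n - 1 ≠ 0 := by linarith
  have h3 := hr.ne'
  have h4 := hα.ne'
  -- Only a rational identity in the derivatives of `p` at the point remains; the denominators are
  -- powers of `r` and `α`, `n` and `n - 1`.
  field_simp
  ring
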